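/- Let $d\in\mathbb N$ and let $P$ be a probability measure on $\mathbb R^d$ with Lebesgue density $p\in W^{2,1}(\mathbb R^d)\cap W^{2,2}(\mathbb R^d)$. Let $K\colon\mathbb R^d\to[0,\infty)$ satisfy $K\in L^1(\mathbb R^d)\cap L^2(\mathbb R^d)$, $\int K(u)\,du=1$, $\int u\,K(u)\,du=0$ and $\int\|u\|^2K(u)\,du<\infty$, and let the bandwidths $h_N>0$ satisfy $h_N\to0$ and $Nh_N^d\to\infty$ as $N\to\infty$. Put $$K_h(x,y)=\frac1{h^d}K\Big(\frac{x-y}h\Big),\qquad \hat q_N(x)=\frac1N\sum_{k=1}^N K_{h_N}(x,Z_k),\qquad \mathbb E_P[K_h(x,\cdot)]=\int K_h(x,z)\,P(dz).$$ Assume that the $Z_k$ are either i.i.d. with law $P$, or form a stationary time-homogeneous Markov chain in $\mathbb R^d$ with transition kernel $T$ and invariant distribution $P$ such that the spectral gap $\gamma$ or the pseudo spectral gap $\gamma_{\mathrm{ps}}$ is positive. Here $T$ acts on $L^2_0(P)=\{f\in L^2(P;\mathbb C):\int f\,dP=0\}$ by $(Tf)(x)=\int f(y)\,T(x,dy)$,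 with adjoint $T^*$; for a bounded operator $A$ on $L^2_0(P)$ put $\gamma(A)=1-\sup\{\operatorname{Re}\lambda:\lambda\in\sigma(A)\}$; and $\gamma=\gamma(T)$, $\gamma_{\mathrm{ps}}=\sup_{k\ge1}\gamma\big((T^*)^kT^k\big)/k$. Then there is a constant $C_{\mathrm{mc}}>0$, depending on the law of the sequence $(Z_k)$ but not on $K$, on the bandwidths or on $N$, such that for all $N\ge1$, with $h=h_N$, $$\int_{\mathbb R^d}\mathbb E\big[(\hat q_N(x)-\mathbb E_P[K_h(x,\cdot)])^2\big]\,dx\le\frac{C_{\mathrm{mc}}}{Nh^d}\|K\|_{L^2(\mathbb R^d)}^2=\mathcal O\Big(\frac1{Nh_N^d}\Big).$$ Moreover, if for certain constants $m>2d$ and $C_p>0$ $$M_{K,m}:=\int_{\mathbb R^d}(1+\|u\|)^mK(u)^2\,du<\infty\qquad\text{and}\qquad p(x)\le C_p(1+\|x\|)^{-m}\ \text{ for almost every }x\in\mathbb R^d,$$ then $C_1:=\sqrt{C_{\mathrm{mc}}C_pM_{K,m}}\int_{\mathbb R^d}(1+\|x\|)^{-m/2}\,dx<\infty$, for all $N\ge1$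 with $h=h_N<1$ $$\int_{\mathbb R^d}\mathbb E\big[|\hat q_N(x)-\mathbb E_P[K_h(x,\cdot)]|\big]\,dx\le\frac{C_1}{\sqrt N\,h^{d/2}},$$ and the left-hand side is $\mathcal O\big(1/(\sqrt N\,h_N^{d/2})\big)$ as $N\to\infty$. -/

import Mathlib

open MeasureTheory ProbabilityTheory Filter Topology Asymptotics
open scoped ENNReal

noncomputable section

/-! ### Sobolev spaces -/

/-- `g` is the weak partial derivative of `f` in the `i`-th coordinate direction. -/
def HasWeakPartial {d : ℕ} (i : Fin d) (f g : EuclideanSpace ℝ (Fin d) → ℝ) : Prop :=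
  ∀ φ : EuclideanSpace ℝ (Fin d) → ℝ, ContDiff ℝ (⊤ : ℕ∞) φ → HasCompactSupport φ →
    ∫ x, f x * fderiv ℝ φ x (EuclideanSpace.single i 1) = -∫ x, g x * φ x

/-- `f ∈ W^{k,q}(ℝ^d)`: all weak partial derivatives of `f` up to order `k` lie in `L^q`. -/
def MemW {d : ℕ} : ℕ → ℝ≥0∞ → (EuclideanSpace ℝ (Fin d) → ℝ) → Prop
  | 0, q, f => MemLp f q volume
  | k + 1, q, f => MemLp f q volume ∧ ∀ i : Fin d, ∃ g, HasWeakPartial i f g ∧ MemW k q g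

/-! ### Assumptions on the density, the kernel and the bandwidth -/

/-- `p` is the Lebesgue density of `P`, and `p ∈ W^{2,1}(ℝ^d) ∩ W^{2,2}(ℝ^d)`. -/
structure IsSobolevDensity {d : ℕ} (P : Measure (EuclideanSpace ℝ (Fin d)))
    (p : EuclideanSpace ℝ (Fin d) → ℝ) : Prop where
  nonneg : 0 ≤ᵐ[volume] p
  density : P = volume.withDensity (fun x => ENNReal.ofReal (p x))
  memW_one : MemW 2 1 p
  memW_two : MemW 2 2 p

/-- The smoothing kernel: nonnegative, in `L¹ ∩ L²`, of total mass one, with vanishing first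
moment and finite second moment. -/
structure IsSmoothingKernel {d : ℕ} (K : EuclideanSpace ℝ (Fin d) → ℝ) : Prop where
  nonneg : ∀ u, 0 ≤ K u
  memLp_one : MemLp K 1 volume
  memLp_two : MemLp K 2 volume
  integral_eq_one : ∫ u, K u = 1
  first_moment : ∫ u, K u • u = 0
  second_moment : Integrable (fun u => ‖u‖ ^ 2 * |K u|) volume

/-- The bandwidth sequence: `h_N > 0`, `h_N → 0` and `N h_N^d → ∞`. -/
structure IsBandwidth (d : ℕ) (h : ℕ → ℝ) : Prop where
  pos : ∀ N, 0 < h N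
  tendsto_zero : Tendsto h atTop (𝓝 0)
  tendsto_atTop : Tendsto (fun N : ℕ => (N : ℝ) * h N ^ d) atTop atTop

/-! ### The kernel density estimator -/

/-- `K_h(x, y) = h^{-d} K((x - y) / h)`. -/
def scaledKernel {d : ℕ} (K : EuclideanSpace ℝ (Fin d) → ℝ) (h : ℝ)
    (x y : EuclideanSpace ℝ (Fin d)) : ℝ :=
  1 / h ^ d * K (h⁻¹ • (x - y))

/-- The estimator `q̂_N(x) = N⁻¹ ∑_k K_h(x, Z_k)` for the outcome `ω`, built on the first `N`
terms `Z 0, …, Z (N - 1)` of the sequence `Z`. -/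
def kde {d : ℕ} {Ω : Type*} (K : EuclideanSpace ℝ (Fin d) → ℝ) (h : ℝ)
    (Z : ℕ → Ω → EuclideanSpace ℝ (Fin d)) (N : ℕ) (ω : Ω) (x : EuclideanSpace ℝ (Fin d)) : ℝ :=
  1 / (N : ℝ) * ∑ k ∈ Finset.range N, scaledKernel K h x (Z k ω)

/-- The stochastic fluctuation `q̂_N(x) - E_P[K_h(x, ·)]`. -/
def kdeDeviation {d : ℕ} {Ω : Type*} (P : Measure (EuclideanSpace ℝ (Fin d)))
    (K : EuclideanSpace ℝ (Fin d) → ℝ) (h : ℝ)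
    (Z : ℕ → Ω → EuclideanSpace ℝ (Fin d)) (N : ℕ) (ω : Ω) (x : EuclideanSpace ℝ (Fin d)) : ℝ :=
  kde K h Z N ω x - ∫ z, scaledKernel K h x z ∂P

/-- The integrated variance `∫ E[(q̂_N(x) - E_P[K_h(x, ·)])²] dx`, with values in `[0, ∞]`. -/
def integratedVariance {d : ℕ} {Ω : Type*} [MeasurableSpace Ω] (μ : Measure Ω)
    (P : Measure (EuclideanSpace ℝ (Fin d))) (K : EuclideanSpace ℝ (Fin d) → ℝ) (h : ℝ)
    (Z : ℕ → Ω → EuclideanSpace ℝ (Fin d)) (N : ℕ) : ℝ≥0∞ :=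
  ∫⁻ x, ∫⁻ ω, ENNReal.ofReal (kdeDeviation P K h Z N ω x ^ 2) ∂μ

/-- The integrated mean absolute deviation `∫ E[|q̂_N(x) - E_P[K_h(x, ·)]|] dx`, with values
in `[0, ∞]`. -/
def integratedMAD {d : ℕ} {Ω : Type*} [MeasurableSpace Ω] (μ : Measure Ω)
    (P : Measure (EuclideanSpace ℝ (Fin d))) (K : EuclideanSpace ℝ (Fin d) → ℝ) (h : ℝ)
    (Z : ℕ → Ω → EuclideanSpace ℝ (Fin d)) (N : ℕ) : ℝ≥0∞ :=
  ∫⁻ x, ∫⁻ ω, ENNReal.ofReal |kdeDeviation P K h Z N ω x| ∂μ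

/-! ### The Markov operator on `L²(P)` and its spectral gaps -/

section MarkovOperator

variable {E : Type*} [MeasurableSpace E] {T : Kernel E E} {P : Measure E}

theorem lintegral_markov (hT : T.Invariant P) {g : E → ℝ≥0∞} (hg : Measurable g) :
    ∫⁻ x, ∫⁻ y, g y ∂T x ∂P = ∫⁻ y, g y ∂P := by
  conv_rhs => rw [← hT.def]
  rw [Measure.lintegral_bind T.aemeasurable hg.aemeasurable]

theorem ae_ae_markov (hT : T.Invariant P) {q : E → Prop} (h : ∀ᵐ y ∂P, q y) :
    ∀ᵐ x ∂P, ∀ᵐ y ∂T x, q y := by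
  rw [← hT.def] at h
  exact Measure.ae_ae_of_ae_bind T.aemeasurable h

theorem eLpNorm_markov_le [IsMarkovKernel T] (hT : T.Invariant P) {f : E → ℂ} (hf : StronglyMeasurable f) :
    eLpNorm (fun x => ∫ y, f y ∂T x) 2 P ≤ eLpNorm f 2 P := by
  have key : ∀ x, ‖∫ y, f y ∂T x‖ₑ ^ (2 : ℝ) ≤ ∫⁻ y, ‖f y‖ₑ ^ (2 : ℝ) ∂T x := by
    intro x
    have h1 : ‖∫ y, f y ∂T x‖ₑ ≤ eLpNorm f 2 (T x) := by
      refine (enorm_integral_le_lintegral_enorm f).trans ?_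
      rw [← eLpNorm_one_eq_lintegral_enorm]
      exact eLpNorm_le_eLpNorm_of_exponent_le (by norm_num) hf.aestronglyMeasurable
    calc ‖∫ y, f y ∂T x‖ₑ ^ (2 : ℝ) ≤ (eLpNorm f 2 (T x)) ^ (2 : ℝ) := by gcongr
      _ = ∫⁻ y, ‖f y‖ₑ ^ (2 : ℝ) ∂T x := by
        rw [eLpNorm_eq_lintegral_rpow_enorm_toReal (by norm_num) (by norm_num),
          ← ENNReal.rpow_mul]
        norm_num
  rw [eLpNorm_eq_lintegral_rpow_enorm_toReal (by norm_num) (by norm_num),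
    eLpNorm_eq_lintegral_rpow_enorm_toReal (by norm_num) (by norm_num)]
  have h2 : (2 : ℝ≥0∞).toReal = 2 := by norm_num
  rw [h2, ← lintegral_markov hT (g := fun y => ‖f y‖ₑ ^ (2 : ℝ))
    (hf.measurable.enorm.pow_const _)]
  gcongr with x
  exact key x

theorem memLp_markov [IsMarkovKernel T] (hT : T.Invariant P) (f : Lp ℂ 2 P) :
    MemLp (fun x => ∫ y, f y ∂T x) 2 P :=
  ⟨(Lp.stronglyMeasurable f).integral_kernel.aestronglyMeasurable,
    (eLpNorm_markov_le hT (Lp.stronglyMeasurable f)).trans_lt (Lp.memLp f).2⟩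

variable [IsProbabilityMeasure P]

theorem ae_integrable_markov (hT : T.Invariant P) (f : Lp ℂ 2 P) :
    ∀ᵐ x ∂P, Integrable f (T x) := by
  have h1 : ∫⁻ x, ∫⁻ y, ‖f y‖ₑ ∂T x ∂P ≠ ∞ := by
    rw [lintegral_markov hT (Lp.stronglyMeasurable f).measurable.enorm]
    exact ((Lp.memLp f).integrable (by norm_num)).2.ne
  filter_upwards [ae_lt_top (Lp.stronglyMeasurable f).measurable.enorm.lintegral_kernel h1]
    with x hx
  exact ⟨(Lp.stronglyMeasurable f).aestronglyMeasurable, hx⟩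

/-- The Markov operator `(T f)(x) = ∫ f(y) T(x, dy)` on the complex Hilbert space `L²(P)`, where
`P` is invariant under the transition kernel `T`. -/
def markovOp (T : Kernel E E) [IsMarkovKernel T] (P : Measure E) [IsProbabilityMeasure P]
    (hT : T.Invariant P) : Lp ℂ 2 P →L[ℂ] Lp ℂ 2 P :=
  LinearMap.mkContinuous
    { toFun := fun f => (memLp_markov hT f).toLp _
      map_add' := by
        intro f g
        rw [← MemLp.toLp_add]
        refine (MemLp.toLp_eq_toLp_iff _ _).2 ?_
        filter_upwards [ae_integrable_markov hT f, ae_integrable_markov hT g,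
          ae_ae_markov hT (Lp.coeFn_add f g)] with x hf hg h
        rw [integral_congr_ae h]
        exact integral_add hf hg
      map_smul' := by
        intro c f
        simp only [RingHom.id_apply]
        rw [← MemLp.toLp_const_smul]
        refine (MemLp.toLp_eq_toLp_iff _ _).2 ?_
        filter_upwards [ae_ae_markov hT (Lp.coeFn_smul c f)] with x h
        rw [integral_congr_ae h]
        exact integral_smul c _ }
    1 (by
      intro f
      simp only [LinearMap.coe_mk, AddHom.coe_mk, one_mul]
      rw [Lp.norm_toLp, Lp.norm_def]
      exact ENNReal.toReal_mono (Lp.memLp f).2.ne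
        (eLpNorm_markov_le hT (Lp.stronglyMeasurable f)))

theorem markovOp_ae [IsMarkovKernel T] (hT : T.Invariant P) (f : Lp ℂ 2 P) :
    markovOp T P hT f =ᵐ[P] fun x => ∫ y, f y ∂T x :=
  (memLp_markov hT f).coeFn_toLp

/-- `L²₀(P)`: the orthogonal complement of the constant functions in `L²(P)`. -/
def L2Zero (P : Measure E) [IsProbabilityMeasure P] : Submodule ℂ (Lp ℂ 2 P) :=
  (Submodule.span ℂ {(memLp_const (μ := P) (p := 2) (1 : ℂ)).toLp _})ᗮ

instance (P : Measure E) [IsProbabilityMeasure P] : CompleteSpace (L2Zero P) :=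
  inferInstanceAs (CompleteSpace (Submodule.span ℂ _)ᗮ)

theorem mem_L2Zero_iff (f : Lp ℂ 2 P) : f ∈ L2Zero P ↔ ∫ x, f x ∂P = 0 := by
  rw [L2Zero, Submodule.mem_orthogonal_singleton_iff_inner_right, L2.inner_def]
  have : ∫ x, inner ℂ (((memLp_const (μ := P) (p := 2) (1 : ℂ)).toLp _ : Lp ℂ 2 P) x) (f x) ∂P
      = ∫ x, f x ∂P := by
    refine integral_congr_ae ?_
    filter_upwards [(memLp_const (μ := P) (p := 2) (1 : ℂ)).coeFn_toLp] with x hx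
    rw [hx]
    simp
  rw [this]

theorem integral_markovOp [IsMarkovKernel T] (hT : T.Invariant P) (f : Lp ℂ 2 P) :
    ∫ x, markovOp T P hT f x ∂P = ∫ x, f x ∂P := by
  rw [integral_congr_ae (markovOp_ae hT f)]
  have hc : (T ∘ₖ Kernel.const Unit P) () = P := by
    rw [Kernel.comp_const, hT.def, Kernel.const_apply]
  have hint : Integrable f ((T ∘ₖ Kernel.const Unit P) ()) := by
    rw [hc]
    exact (Lp.memLp f).integrable (by norm_num)
  have h := Kernel.integral_comp hint
  rw [hc, Kernel.const_apply] at h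
  exact h.symm

theorem mapsTo_L2Zero [IsMarkovKernel T] (hT : T.Invariant P) :
    ∀ f ∈ L2Zero P, markovOp T P hT f ∈ L2Zero P := by
  intro f hf
  rw [mem_L2Zero_iff] at hf ⊢
  rw [integral_markovOp hT, hf]

/-- The restriction of the Markov operator to `L²₀(P)`. -/
def markovOpZero (T : Kernel E E) [IsMarkovKernel T] (P : Measure E) [IsProbabilityMeasure P]
    (hT : T.Invariant P) : L2Zero P →L[ℂ] L2Zero P :=
  (markovOp T P hT).restrict (mapsTo_L2Zero hT)

/-- The gap `1 - sup {Re λ : λ ∈ σ(A)}` of an operator on `L²₀(P)`. For self-adjoint `A` the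
spectrum is real and this is the usual `1 - sup σ(A)`. -/
def operatorGap {P : Measure E} [IsProbabilityMeasure P] (A : L2Zero P →L[ℂ] L2Zero P) : ℝ :=
  1 - sSup (Complex.re '' spectrum ℂ A)

/-- The spectral gap `γ` of the transition kernel `T` with invariant distribution `P`. -/
def spectralGap (T : Kernel E E) [IsMarkovKernel T] (P : Measure E) [IsProbabilityMeasure P]
    (hT : T.Invariant P) : ℝ :=
  operatorGap (markovOpZero T P hT)

/-- The pseudo spectral gap `γ_ps = sup_{k ≥ 1} γ((T*)^k T^k) / k`. -/
def pseudoSpectralGap (T : Kernel E E) [IsMarkovKernel T] (P : Measure E)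
    [IsProbabilityMeasure P] (hT : T.Invariant P) : ℝ :=
  ⨆ k : ℕ+, operatorGap
    ((ContinuousLinearMap.adjoint (markovOpZero T P hT)) ^ (k : ℕ)
      * (markovOpZero T P hT) ^ (k : ℕ)) / (k : ℝ)

end MarkovOperator

/-! ### Assumptions on the data -/

/-- `Z` is a time-homogeneous Markov chain with transition kernel `T`:
`μ(Z_{n+1} ∈ A | Z_0, …, Z_n) = T(Z_n, A)` almost surely. -/
structure IsMarkovChain {E Ω : Type*} [MeasurableSpace E] [MeasurableSpace Ω]
    (T : Kernel E E) (Z : ℕ → Ω → E) (μ : Measure Ω) : Prop where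
  measurable : ∀ n, Measurable (Z n)
  markov : ∀ (n : ℕ) (A : Set E), MeasurableSet A →
    μ⟦Z (n + 1) ⁻¹' A | ⨆ j ≤ n, MeasurableSpace.comap (Z j) inferInstance⟧
      =ᵐ[μ] fun ω => (T (Z n ω)).real A

/-- `Z_0, Z_1, …` are i.i.d. with law `P`. -/
def IsIIDSample {E Ω : Type*} [MeasurableSpace E] [MeasurableSpace Ω]
    (Z : ℕ → Ω → E) (P : Measure E) (μ : Measure Ω) : Prop :=
  (∀ n, Measurable (Z n)) ∧ (∀ n, μ.map (Z n) = P) ∧ iIndepFun Z μ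

/-- `Z` is a Markov chain with invariant distribution `P`, started in `P`, that has a spectral gap
`γ > 0` or a pseudo spectral gap `γ_ps > 0`. -/
def IsStationaryChainWithGap {E Ω : Type*} [MeasurableSpace E] [MeasurableSpace Ω]
    (Z : ℕ → Ω → E) (P : Measure E) [IsProbabilityMeasure P] (μ : Measure Ω) : Prop :=
  ∃ (T : Kernel E E) (_ : IsMarkovKernel T) (hT : T.Invariant P),
    IsMarkovChain T Z μ ∧ μ.map (Z 0) = P ∧
      (0 < spectralGap T P hT ∨ 0 < pseudoSpectralGap T P hT)

end

/-!
The value of the estimator at `x` is the average of `g = K_h(x, ·)` along the sample, so everything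
reduces to showing that the variance of `∑ k < N, g (Z k)` is at most `C * N` times the variance of
`g`, with `C` independent of `g`. For independent samples this is additivity of the variance. For a
Markov chain, either spectral gap makes `1 - T` invertible on `L²₀(P)`, so that centred functions
can be written `f = φ - T φ` with `‖φ‖ ≤ R * ‖f‖`. Gordin's decomposition then writes
`∑ k < N, f (Z k)` as a boundary term `φ (Z 0) - φ (Z N)` plus a sum of the innovations
`φ (Z (k + 1)) - (T φ) (Z k)`, which are orthogonal and of norm at most `‖φ‖`.

Integrating the second moment of `K_h(x, ·)` over `x` first gives exactly `h⁻ᵈ ‖K‖²`. For the mean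
absolute deviation, Cauchy–Schwarz is applied at each fixed `x`; the decay of the density is moved
from `z` to `x` by `1 + ‖x‖ ≤ (1 + ‖z‖) * (1 + ‖(x - z) / h‖)`, valid for `h ≤ 1`, and the
resulting bound is a multiple of the integrable weight `(1 + ‖x‖) ^ (-m / 2)`.
-/

/-! ### Isometric dilations of a Markov operator -/

section Dilation

variable {𝕜 F H : Type*} [RCLike 𝕜] [NormedAddCommGroup F] [NormedSpace 𝕜 F]
  [NormedAddCommGroup H] [InnerProductSpace 𝕜 H]

/-- A sequence of isometries `U n` along which `T` acts as the one-step conditional expectation: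
`U (n + 1) g` and `U n (T g)` have the same inner products with the past. For a stationary Markov
chain, `U n` is composition with the `n`-th state and `T` is the Markov operator. -/
def IsMarkovDilation (U : ℕ → F →ₗᵢ[𝕜] H) (T : F → F) : Prop :=
  ∀ j n, j ≤ n → ∀ f g, inner 𝕜 (U j f) (U (n + 1) g) = inner 𝕜 (U j f) (U n (T g))

/-- The innovation `U (n + 1) g - U n (T g)`, the martingale difference of the dilation at time
`n + 1`. -/
def innovation (U : ℕ → F →ₗᵢ[𝕜] H) (T : F → F) (g : F) (n : ℕ) : H :=
  U (n + 1) g - U n (T g)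

variable {U : ℕ → F →ₗᵢ[𝕜] H} {T : F → F}

theorem sum_apply_sub_eq_sub_add_sum_innovation (g : F) (N : ℕ) :
    ∑ k ∈ Finset.range N, U k (g - T g)
      = U 0 g - U N g + ∑ k ∈ Finset.range N, innovation U T g k := by
  rw [← Finset.sum_range_sub' fun k => U k g, ← Finset.sum_add_distrib]
  refine Finset.sum_congr rfl fun k _ => ?_
  rw [map_sub, innovation, sub_add_sub_cancel]

namespace IsMarkovDilation

theorem inner_innovation_eq_zero (hU : IsMarkovDilation U T) {j n : ℕ} (hj : j ≤ n) (f g : F) :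
    inner 𝕜 (U j f) (innovation U T g n) = 0 := by
  rw [innovation, inner_sub_right, hU j n hj, sub_self]

theorem inner_innovation_innovation_eq_zero (hU : IsMarkovDilation U T) {j n : ℕ} (hj : j < n)
    (f g : F) : inner 𝕜 (innovation U T f j) (innovation U T g n) = 0 := by
  rw [innovation.eq_1 U T f, inner_sub_left, hU.inner_innovation_eq_zero hj,
    hU.inner_innovation_eq_zero hj.le, sub_zero]

theorem norm_innovation_le (hU : IsMarkovDilation U T) (g : F) (n : ℕ) :
    ‖innovation U T g n‖ ≤ ‖g‖ := by
  have hpythagoras := norm_add_sq_eq_norm_sq_add_norm_sq_of_inner_eq_zero _ _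
    (hU.inner_innovation_eq_zero le_rfl (T g) g (n := n))
  rw [innovation, add_sub_cancel, ← innovation, LinearIsometry.norm_map] at hpythagoras
  nlinarith [norm_nonneg g, norm_nonneg (U n (T g)), norm_nonneg (innovation U T g n)]

theorem norm_sum_innovation_sq_le (hU : IsMarkovDilation U T) (g : F) (N : ℕ) :
    ‖∑ k ∈ Finset.range N, innovation U T g k‖ ^ 2 ≤ N * ‖g‖ ^ 2 := by
  induction N with
  | zero => simp
  | succ N ih =>
    have horth : inner 𝕜 (∑ k ∈ Finset.range N, innovation U T g k) (innovation U T g N) = 0 := by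
      rw [sum_inner]
      exact Finset.sum_eq_zero fun k hk =>
        hU.inner_innovation_innovation_eq_zero (Finset.mem_range.1 hk) g g
    have hN : ‖innovation U T g N‖ ^ 2 ≤ ‖g‖ ^ 2 := by gcongr; exact hU.norm_innovation_le g N
    rw [Finset.sum_range_succ, norm_add_sq (𝕜 := 𝕜), horth, map_zero]
    push_cast
    linarith

theorem norm_sum_apply_sub_sq_le (hU : IsMarkovDilation U T) (g : F) (N : ℕ) :
    ‖∑ k ∈ Finset.range N, U k (g - T g)‖ ^ 2 ≤ 9 * N * ‖g‖ ^ 2 := by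
  rcases N.eq_zero_or_pos with rfl | hN
  · simp
  have hN1 : (1 : ℝ) ≤ √N := Real.one_le_sqrt.2 (by exact_mod_cast hN)
  have hinnov : ‖∑ k ∈ Finset.range N, innovation U T g k‖ ≤ √N * ‖g‖ := by
    refine abs_le_of_sq_le_sq' ?_ (by positivity) |>.2
    rw [mul_pow, Real.sq_sqrt N.cast_nonneg]
    exact hU.norm_sum_innovation_sq_le g N
  have hsum : ‖∑ k ∈ Finset.range N, U k (g - T g)‖ ≤ 3 * √N * ‖g‖ := by
    rw [sum_apply_sub_eq_sub_add_sum_innovation]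
    calc _ ≤ ‖U 0 g‖ + ‖U N g‖ + ‖∑ k ∈ Finset.range N, innovation U T g k‖ :=
          (norm_add_le _ _).trans (by gcongr; exact norm_sub_le _ _)
      _ ≤ √N * ‖g‖ + √N * ‖g‖ + √N * ‖g‖ := by
        simp only [LinearIsometry.norm_map]
        gcongr <;> exact le_mul_of_one_le_left (norm_nonneg g) hN1
      _ = 3 * √N * ‖g‖ := by ring
  calc _ ≤ (3 * √N * ‖g‖) ^ 2 := by gcongr
    _ = 9 * N * ‖g‖ ^ 2 := by rw [mul_pow, mul_pow, Real.sq_sqrt N.cast_nonneg]; norm_num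

end IsMarkovDilation

end Dilation

/-! ### Spectral gaps and the Poisson equation -/

section SpectralGap

open scoped ComplexOrder in
theorem norm_lt_one_of_re_lt_one_on_spectrum_star_mul_self {A : Type*} [CStarAlgebra A] {b : A}
    (h : ∀ z ∈ spectrum ℂ (star b * b), z.re < 1) : ‖b‖ < 1 := by
  nontriviality A
  let _ := CStarAlgebra.spectralOrder A
  have _ := CStarAlgebra.spectralOrderedRing A
  have hmem : ‖star b * b‖ ∈ spectrum ℝ (star b * b) :=
    CStarAlgebra.norm_mem_spectrum_of_nonneg (star_mul_self_nonneg b)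
  have hlt := h _ ((spectrum.algebraMap_mem_iff ℂ).2 hmem)
  rw [CStarRing.norm_star_mul_self] at hlt
  have : ‖b‖ * ‖b‖ < 1 := hlt
  nlinarith [norm_nonneg b]

theorem isUnit_one_sub_of_isUnit_one_sub_pow {R : Type*} [Ring R] {a : R} {k : ℕ}
    (h : IsUnit (1 - a ^ k)) : IsUnit (1 - a) := by
  rw [← mul_neg_geom_sum] at h
  refine ((Commute.isUnit_mul_iff ?_).1 h).1
  rw [commute_iff_eq, mul_neg_geom_sum, geom_sum_mul_neg]

theorem re_lt_one_of_sSup_re_spectrum_lt_one {A : Type*} [NormedRing A] [NormedAlgebra ℂ A]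
    [CompleteSpace A] {a : A} (ha : sSup (Complex.re '' spectrum ℂ a) < 1) {z : ℂ}
    (hz : z ∈ spectrum ℂ a) : z.re < 1 :=
  (le_csSup ((spectrum.isCompact a).image Complex.continuous_re).bddAbove
    (Set.mem_image_of_mem _ hz)).trans_lt ha

theorem isUnit_one_sub_of_sSup_re_spectrum_lt_one {A : Type*} [NormedRing A] [NormedAlgebra ℂ A]
    [CompleteSpace A] {a : A} (ha : sSup (Complex.re '' spectrum ℂ a) < 1) :
    IsUnit (1 - a) := by
  by_contra hu
  have hmem : (1 : ℂ) ∈ spectrum ℂ a := by rwa [spectrum.mem_iff, map_one]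
  exact (re_lt_one_of_sSup_re_spectrum_lt_one ha hmem).ne Complex.one_re

theorem isUnit_one_sub_of_sSup_re_spectrum_adjoint_pow_mul_pow_lt_one {F : Type*}
    [NormedAddCommGroup F] [InnerProductSpace ℂ F] [CompleteSpace F] {A : F →L[ℂ] F} {k : ℕ}
    (hA : sSup (Complex.re '' spectrum ℂ (ContinuousLinearMap.adjoint A ^ k * A ^ k)) < 1) :
    IsUnit (1 - A) := by
  refine isUnit_one_sub_of_isUnit_one_sub_pow (k := k)
    (isUnit_one_sub_of_norm_lt_one (R := F →L[ℂ] F) ?_)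
  refine norm_lt_one_of_re_lt_one_on_spectrum_star_mul_self fun z hz => ?_
  rw [star_pow, ContinuousLinearMap.star_eq_adjoint] at hz
  exact re_lt_one_of_sSup_re_spectrum_lt_one hA hz

variable {E : Type*} [MeasurableSpace E] {P : Measure E} [IsProbabilityMeasure P]
  {T : Kernel E E} [IsMarkovKernel T]

theorem isUnit_one_sub_markovOpZero {hT : T.Invariant P}
    (hgap : 0 < spectralGap T P hT ∨ 0 < pseudoSpectralGap T P hT) :
    IsUnit (1 - markovOpZero T P hT) := by
  rcases hgap with hgap | hgap
  · rw [spectralGap, operatorGap] at hgap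
    exact isUnit_one_sub_of_sSup_re_spectrum_lt_one (A := L2Zero P →L[ℂ] L2Zero P)
      (sub_pos.1 hgap)
  · obtain ⟨k, hk⟩ := exists_lt_of_lt_ciSup hgap
    have hgapk := (div_pos_iff_of_pos_right (Nat.cast_pos.2 k.pos)).1 hk
    rw [operatorGap] at hgapk
    exact isUnit_one_sub_of_sSup_re_spectrum_adjoint_pow_mul_pow_lt_one (sub_pos.1 hgapk)

theorem exists_sub_markovOp_eq {hT : T.Invariant P} (hu : IsUnit (1 - markovOpZero T P hT)) :
    ∃ C : ℝ, 0 < C ∧ ∀ f ∈ L2Zero P, ∃ g : Lp ℂ 2 P,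
      g - markovOp T P hT g = f ∧ ‖g‖ ≤ C * ‖f‖ := by
  obtain ⟨R, hR⟩ := hu.exists_right_inv
  refine ⟨‖R‖ + 1, by positivity, fun f hf => ⟨R ⟨f, hf⟩, ?_, ?_⟩⟩
  · exact congrArg Subtype.val (DFunLike.congr_fun hR ⟨f, hf⟩)
  · calc ‖R ⟨f, hf⟩‖ ≤ ‖R‖ * ‖f‖ := R.le_opNorm _
      _ ≤ (‖R‖ + 1) * ‖f‖ := by gcongr; linarith

end SpectralGap

/-! ### Markov chains as dilations -/

section Chain

variable {Ω E G : Type*} [MeasurableSpace E] [MeasurableSpace G]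

theorem hasCondDistrib_of_condExp_indicator_ae_eq {m mΩ : MeasurableSpace Ω} {μ : Measure Ω}
    [IsFiniteMeasure μ] (hm : m ≤ mΩ) {X : Ω → G} {Y : Ω → E} {κ : Kernel G E} [IsFiniteKernel κ]
    (hX : Measurable[m] X) (hY : Measurable Y)
    (h : ∀ B, MeasurableSet B → μ⟦Y ⁻¹' B | m⟧ =ᵐ[μ] fun ω => (κ (X ω)).real B) :
    HasCondDistrib Y X κ μ := by
  have hX' : Measurable X := hX.mono hm le_rfl
  refine ⟨by fun_prop, Measure.ext_prod fun {s B} hs hB => ?_⟩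
  have hκ : Integrable (fun ω => (κ (X ω)).real B) μ := integrable_condExp.congr (h B hB)
  have hreal : ∫ ω in X ⁻¹' s, (κ (X ω)).real B ∂μ = μ.real (X ⁻¹' s ∩ Y ⁻¹' B) := by
    rw [← setIntegral_congr_ae (hm _ (hX hs)) ((h B hB).mono fun ω hω _ => hω),
      setIntegral_condExp hm ((integrable_const _).indicator (hY hB)) (hX hs),
      setIntegral_indicator (hY hB), setIntegral_const, smul_eq_mul, mul_one]
  rw [Measure.map_apply (hX'.prodMk hY) (hs.prod hB), Measure.compProd_apply_prod hs hB,
    setLIntegral_map hs (Kernel.measurable_coe _ hB) hX', Set.mk_preimage_prod,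
    ← ofReal_measureReal, ← hreal, ofReal_integral_eq_lintegral_ofReal hκ.integrableOn
      (ae_of_all _ fun _ => measureReal_nonneg)]
  exact lintegral_congr fun _ => ofReal_measureReal

variable [MeasurableSpace Ω] {μ : Measure Ω}

theorem integral_mul_of_hasCondDistrib {𝕜 : Type*} [RCLike 𝕜] [SFinite μ] {X : Ω → G}
    {Y : Ω → E} {κ : Kernel G E} [IsSFiniteKernel κ] (h : HasCondDistrib Y X κ μ) {f : G → 𝕜}
    {g : E → 𝕜} (hf : StronglyMeasurable f) (hg : StronglyMeasurable g)
    (hint : Integrable (fun ω => g (Y ω) * f (X ω)) μ) :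
    ∫ ω, g (Y ω) * f (X ω) ∂μ = ∫ ω, (∫ y, g y ∂κ (X ω)) * f (X ω) ∂μ := by
  have hgf : StronglyMeasurable fun q : G × E => g q.2 * f q.1 :=
    (hg.comp_measurable measurable_snd).mul (hf.comp_measurable measurable_fst)
  have hmap : Integrable (fun q : G × E => g q.2 * f q.1) (μ.map X ⊗ₘ κ) := by
    rwa [← h.map_eq, integrable_map_measure hgf.aestronglyMeasurable h.aemeasurable]
  calc ∫ ω, g (Y ω) * f (X ω) ∂μ
      = ∫ q, g q.2 * f q.1 ∂μ.map fun ω => (X ω, Y ω) :=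
        (integral_map h.aemeasurable hgf.aestronglyMeasurable).symm
    _ = ∫ x, (∫ y, g y ∂κ x) * f x ∂μ.map X := by
      rw [h.map_eq, Measure.integral_compProd hmap]
      simp only [integral_mul_const]
    _ = ∫ ω, (∫ y, g y ∂κ (X ω)) * f (X ω) ∂μ :=
      integral_map h.aemeasurable_fst (hg.integral_kernel.mul hf).aestronglyMeasurable

variable [IsProbabilityMeasure μ] {P : Measure E} {T : Kernel E E} [IsMarkovKernel T]
  {Z : ℕ → Ω → E}

namespace IsMarkovChain

theorem hasCondDistrib_prodMk (hZ : IsMarkovChain T Z μ) {j n : ℕ} (hj : j ≤ n) :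
    HasCondDistrib (Z (n + 1)) (fun ω => (Z j ω, Z n ω)) (T.prodMkLeft E) μ := by
  have hpast : ∀ i ≤ n, Measurable[⨆ i ≤ n, MeasurableSpace.comap (Z i) inferInstance] (Z i) :=
    fun i hi => Measurable.of_comap_le
      (le_iSup₂_of_le (f := fun i (_ : i ≤ n) => MeasurableSpace.comap (Z i) inferInstance)
        i hi le_rfl)
  exact hasCondDistrib_of_condExp_indicator_ae_eq
    (iSup₂_le fun i _ => (hZ.measurable i).comap_le)
    ((hpast j hj).prodMk (hpast n le_rfl)) (hZ.measurable (n + 1)) (hZ.markov n)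

theorem measurePreserving (hZ : IsMarkovChain T Z μ) (hT : T.Invariant P) (h0 : μ.map (Z 0) = P)
    (n : ℕ) : MeasurePreserving (Z n) μ P := by
  refine ⟨hZ.measurable n, ?_⟩
  induction n with
  | zero => exact h0
  | succ n ih =>
    have hlaw : HasCondDistrib (Z (n + 1)) (Z n) T μ :=
      (hZ.hasCondDistrib_prodMk le_rfl).comp_right
    calc μ.map (Z (n + 1)) = (μ.map fun ω => (Z n ω, Z (n + 1) ω)).snd :=
          (Measure.snd_map_prodMk (hZ.measurable n)).symm
      _ = P := by rw [hlaw.map_eq, Measure.snd_compProd, ih, hT.def]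

theorem isMarkovDilation [IsProbabilityMeasure P] (hZ : IsMarkovChain T Z μ) (hT : T.Invariant P)
    (hP : ∀ n, MeasurePreserving (Z n) μ P) :
    IsMarkovDilation (fun n => Lp.compMeasurePreservingₗᵢ ℂ (Z n) (hP n))
      (markovOp T P hT) := by
  intro j n hj f g
  have hcomp : ∀ (i : ℕ) (u : Lp ℂ 2 P),
      Lp.compMeasurePreservingₗᵢ ℂ (Z i) (hP i) u =ᵐ[μ] fun ω => u (Z i ω) :=
    fun i u => Lp.coeFn_compMeasurePreserving u (hP i)
  have hinner : ∀ (i : ℕ) (u : Lp ℂ 2 P), (fun ω => inner ℂ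
      (Lp.compMeasurePreservingₗᵢ ℂ (Z j) (hP j) f ω)
      (Lp.compMeasurePreservingₗᵢ ℂ (Z i) (hP i) u ω))
      =ᵐ[μ] fun ω => u (Z i ω) * starRingEnd ℂ (f (Z j ω)) := fun i u => by
    filter_upwards [hcomp j f, hcomp i u] with ω hf hu
    rw [hf, hu, RCLike.inner_apply]
  have hstar : StronglyMeasurable fun q : E × E => starRingEnd ℂ (f q.1) :=
    RCLike.continuous_conj.comp_stronglyMeasurable
      ((Lp.stronglyMeasurable f).comp_measurable measurable_fst)
  rw [L2.inner_def, L2.inner_def, integral_congr_ae (hinner (n + 1) g),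
    integral_congr_ae (hinner n _),
    integral_mul_of_hasCondDistrib (hZ.hasCondDistrib_prodMk hj) hstar
      (Lp.stronglyMeasurable g) ((L2.integrable_inner _ _).congr (hinner (n + 1) g))]
  refine integral_congr_ae ?_
  filter_upwards [(hP n).quasiMeasurePreserving.ae (markovOp_ae hT g)] with ω hω
  rw [Kernel.prodMkLeft_apply, hω]

end IsMarkovChain

end Chain

/-! ### Variance of additive functionals -/

section VarianceGrowth

variable {Ω E : Type*} [MeasurableSpace Ω] [MeasurableSpace E] {μ : Measure Ω} {P : Measure E}
  {Z : ℕ → Ω → E}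

/-- The variance of `∑ k < N, g (Z k)` is at most `C * N` times the variance of `g` under `P`, for
every `g ∈ L²(P)`. Independent samples have `C = 1`; for a Markov chain, `C` measures the speed of
mixing. -/
def HasLinearVarianceGrowth (C : ℝ) (Z : ℕ → Ω → E) (P : Measure E) (μ : Measure Ω) : Prop :=
  ∀ g : E → ℝ, MemLp g 2 P → ∀ N : ℕ,
    Var[fun ω => ∑ k ∈ Finset.range N, g (Z k ω); μ] ≤ C * N * Var[g; P]

namespace IsIIDSample

theorem measurePreserving (hZ : IsIIDSample Z P μ) (n : ℕ) : MeasurePreserving (Z n) μ P :=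
  ⟨hZ.1 n, hZ.2.1 n⟩

theorem hasLinearVarianceGrowth (hZ : IsIIDSample Z P μ) : HasLinearVarianceGrowth 1 Z P μ := by
  intro g hg N
  have hgZ : ∀ k, AEMeasurable g (μ.map (Z k)) := fun k => by
    rw [(hZ.measurePreserving k).map_eq]
    exact hg.1.aemeasurable
  have hindep : iIndepFun (fun k => g ∘ Z k) μ :=
    hZ.2.2.comp₀ _ (fun k => (hZ.1 k).aemeasurable) hgZ
  have hvar : ∀ k, Var[g ∘ Z k; μ] = Var[g; P] := fun k =>
    (hZ.measurePreserving k).variance_fun_comp hg.1.aemeasurable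
  have hsum := IndepFun.variance_sum (s := Finset.range N)
    (fun k _ => hg.comp_measurePreserving (hZ.measurePreserving k))
    fun i _ j _ hij => hindep.indepFun hij
  simp only [hvar, Finset.sum_const, Finset.card_range, nsmul_eq_mul] at hsum
  rw [one_mul, ← hsum, Finset.sum_fn]
  rfl

end IsIIDSample

theorem norm_sq_eq_variance_of_ae_eq {X : Ω → ℝ} (hX : AEMeasurable X μ) {u : Lp ℂ 2 μ}
    (hu : u =ᵐ[μ] fun ω => ((X ω - μ[X] : ℝ) : ℂ)) : ‖u‖ ^ 2 = Var[X; μ] := by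
  have hinner : (fun ω => inner ℂ (u ω) (u ω))
      =ᵐ[μ] fun ω => (((X ω - μ[X]) ^ 2 : ℝ) : ℂ) := by
    filter_upwards [hu] with ω hω
    rw [hω, RCLike.inner_apply, Complex.conj_ofReal, sq, Complex.ofReal_mul]
  rw [norm_sq_eq_re_inner (𝕜 := ℂ) u, L2.inner_def, integral_congr_ae hinner,
    integral_complex_ofReal, variance_eq_integral hX]
  rfl

theorem exists_mem_L2Zero_ae_eq_sub_integral [IsProbabilityMeasure P] {g : E → ℝ}
    (hg : MemLp g 2 P) : ∃ f ∈ L2Zero P, f =ᵐ[P] fun z => ((g z - P[g] : ℝ) : ℂ) := by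
  have hf : MemLp (fun z => ((g z - P[g] : ℝ) : ℂ)) 2 P := (hg.sub (memLp_const _)).ofReal
  refine ⟨hf.toLp _, ?_, hf.coeFn_toLp⟩
  rw [mem_L2Zero_iff, integral_congr_ae hf.coeFn_toLp, integral_complex_ofReal,
    integral_sub (hg.integrable one_le_two) (integrable_const _), integral_const, probReal_univ,
    one_smul, sub_self, Complex.ofReal_zero]

theorem norm_sum_compMeasurePreserving_sq_eq_variance [IsFiniteMeasure μ]
    (hP : ∀ n, MeasurePreserving (Z n) μ P) {g : E → ℝ} (hg : MemLp g 2 P) {f : Lp ℂ 2 P}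
    (hf : f =ᵐ[P] fun z => ((g z - P[g] : ℝ) : ℂ)) (N : ℕ) :
    ‖∑ k ∈ Finset.range N, Lp.compMeasurePreservingₗᵢ ℂ (Z k) (hP k) f‖ ^ 2
      = Var[fun ω => ∑ k ∈ Finset.range N, g (Z k ω); μ] := by
  have hgZ : ∀ k, MemLp (fun ω => g (Z k ω)) 2 μ := fun k => hg.comp_measurePreserving (hP k)
  have hmean : ∀ k, ∫ ω, g (Z k ω) ∂μ = P[g] := fun k =>
    (hP k).hasLaw.integral_comp hg.1
  have hcomp : ∀ k, Lp.compMeasurePreservingₗᵢ ℂ (Z k) (hP k) f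
      =ᵐ[μ] fun ω => ((g (Z k ω) - P[g] : ℝ) : ℂ) := fun k =>
    (Lp.coeFn_compMeasurePreserving f (hP k)).trans
      ((hP k).quasiMeasurePreserving.ae_eq_comp hf)
  refine norm_sq_eq_variance_of_ae_eq (Finset.aemeasurable_fun_sum _ fun k _ =>
    (hgZ k).1.aemeasurable) ?_
  filter_upwards [Lp.coeFn_finsetSum (Finset.range N) fun k =>
    Lp.compMeasurePreservingₗᵢ ℂ (Z k) (hP k) f, ae_all_iff.2 hcomp] with ω hsum hω
  rw [hsum, Finset.sum_apply, integral_finsetSum _ fun k _ => (hgZ k).integrable one_le_two,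
    ← Finset.sum_sub_distrib, Complex.ofReal_sum]
  exact Finset.sum_congr rfl fun k _ => by rw [hω, hmean]

theorem integral_average_comp (hP : ∀ n, MeasurePreserving (Z n) μ P) {g : E → ℝ}
    (hg : Integrable g P) {N : ℕ} (hN : N ≠ 0) :
    ∫ ω, 1 / (N : ℝ) * ∑ k ∈ Finset.range N, g (Z k ω) ∂μ = ∫ z, g z ∂P := by
  have hmean : ∀ k, ∫ ω, g (Z k ω) ∂μ = ∫ z, g z ∂P := fun k =>
    (hP k).hasLaw.integral_comp hg.1
  have hint : ∀ k, Integrable (fun ω => g (Z k ω)) μ := fun k =>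
    (hP k).integrable_comp_of_integrable hg
  rw [integral_const_mul, integral_finsetSum _ fun k _ => hint k]
  simp only [hmean, Finset.sum_const, Finset.card_range, nsmul_eq_mul]
  field_simp

variable [IsProbabilityMeasure μ] [IsProbabilityMeasure P]

theorem IsMarkovChain.exists_hasLinearVarianceGrowth {T : Kernel E E} [IsMarkovKernel T]
    (hZ : IsMarkovChain T Z μ) {hT : T.Invariant P} (hP : ∀ n, MeasurePreserving (Z n) μ P)
    (hu : IsUnit (1 - markovOpZero T P hT)) : ∃ C : ℝ, 0 < C ∧ HasLinearVarianceGrowth C Z P μ := by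
  obtain ⟨R, hR, hpoisson⟩ := exists_sub_markovOp_eq hu
  refine ⟨9 * R ^ 2, by positivity, fun g hg N => ?_⟩
  obtain ⟨f, hf0, hf⟩ := exists_mem_L2Zero_ae_eq_sub_integral hg
  obtain ⟨φ, rfl, hφ⟩ := hpoisson f hf0
  rw [← norm_sum_compMeasurePreserving_sq_eq_variance hP hg hf,
    ← norm_sq_eq_variance_of_ae_eq hg.1.aemeasurable hf]
  calc _ ≤ 9 * N * ‖φ‖ ^ 2 := (hZ.isMarkovDilation hT hP).norm_sum_apply_sub_sq_le φ N
    _ ≤ 9 * N * (R * ‖φ - markovOp T P hT φ‖) ^ 2 := by gcongr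
    _ = 9 * R ^ 2 * N * ‖φ - markovOp T P hT φ‖ ^ 2 := by ring

theorem measurePreserving_and_exists_hasLinearVarianceGrowth
    (hZ : IsIIDSample Z P μ ∨ IsStationaryChainWithGap Z P μ) :
    (∀ n, MeasurePreserving (Z n) μ P) ∧ ∃ C : ℝ, 0 < C ∧ HasLinearVarianceGrowth C Z P μ := by
  rcases hZ with hZ | ⟨T, _, hT, hZ, h0, hgap⟩
  · exact ⟨hZ.measurePreserving, 1, one_pos, hZ.hasLinearVarianceGrowth⟩
  · have hP := hZ.measurePreserving hT h0
    exact ⟨hP, hZ.exists_hasLinearVarianceGrowth hP (isUnit_one_sub_markovOpZero hgap)⟩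

theorem HasLinearVarianceGrowth.lintegral_sq_average_sub_le {C : ℝ} (hC : 0 < C)
    (hZ : HasLinearVarianceGrowth C Z P μ) (hP : ∀ n, MeasurePreserving (Z n) μ P) {g : E → ℝ}
    (hg : AEStronglyMeasurable g P) {N : ℕ} (hN : N ≠ 0) :
    ∫⁻ ω, ENNReal.ofReal ((1 / (N : ℝ) * ∑ k ∈ Finset.range N, g (Z k ω) - ∫ z, g z ∂P) ^ 2) ∂μ
      ≤ ENNReal.ofReal (C / N) * ∫⁻ z, ENNReal.ofReal (g z ^ 2) ∂P := by
  by_cases hL2 : MemLp g 2 P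
  · have hX : MemLp (fun ω => 1 / (N : ℝ) * ∑ k ∈ Finset.range N, g (Z k ω)) 2 μ :=
      (memLp_finsetSum _ fun k _ => hL2.comp_measurePreserving (hP k)).const_mul _
    rw [← integral_average_comp hP (hL2.integrable one_le_two) hN, ← evariance_eq_lintegral_ofReal,
      ← ofReal_variance hX, variance_const_mul, ← ofReal_integral_eq_lintegral_ofReal
        hL2.integrable_sq (ae_of_all _ fun _ => sq_nonneg _), ← ENNReal.ofReal_mul (by positivity)]
    refine ENNReal.ofReal_le_ofReal ?_
    calc _ ≤ (1 / (N : ℝ)) ^ 2 * (C * N * P[g ^ 2]) := by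
          gcongr
          exact (hZ g hL2 N).trans (by gcongr; exact variance_le_expectation_sq hg)
      _ = C / N * P[g ^ 2] := by field_simp
  · have htop : ∫⁻ z, ENNReal.ofReal (g z ^ 2) ∂P = ∞ := by
      by_contra hfin
      refine hL2 ((memLp_two_iff_integrable_sq hg).2 ⟨hg.pow 2, ?_⟩)
      rw [hasFiniteIntegral_iff_ofReal (ae_of_all _ fun z => sq_nonneg _)]
      exact lt_top_iff_ne_top.2 hfin
    rw [htop, ENNReal.mul_top (ENNReal.ofReal_pos.2 (by positivity)).ne']
    exact le_top

end VarianceGrowth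

/-! ### Scaled kernels -/

section ScaledKernel

theorem rpow_neg_one_add_norm_le_mul {E : Type*} [NormedAddCommGroup E] [NormedSpace ℝ E]
    {m h : ℝ} (hm : 0 ≤ m) (hh : 0 < h) (hh1 : h ≤ 1) (x z : E) :
    (1 + ‖z‖) ^ (-m) ≤ (1 + ‖x‖) ^ (-m) * (1 + ‖h⁻¹ • (x - z)‖) ^ m := by
  have hscale : ‖x - z‖ ≤ ‖h⁻¹ • (x - z)‖ := by
    rw [norm_smul, Real.norm_of_nonneg (inv_nonneg.2 hh.le)]
    exact le_mul_of_one_le_left (norm_nonneg _) ((one_le_inv₀ hh).2 hh1)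
  have hpeetre : 1 + ‖x‖ ≤ (1 + ‖z‖) * (1 + ‖h⁻¹ • (x - z)‖) := by
    nlinarith [norm_le_norm_add_norm_sub z x, norm_sub_rev z x,
      mul_nonneg (norm_nonneg z) (norm_nonneg (h⁻¹ • (x - z)))]
  rw [Real.rpow_neg (by positivity), Real.rpow_neg (by positivity), inv_mul_eq_div,
    le_div_iff₀ (by positivity), inv_mul_le_iff₀ (by positivity),
    ← Real.mul_rpow (by positivity) (by positivity)]
  exact Real.rpow_le_rpow (by positivity) hpeetre hm

section HaarMeasure

variable {E : Type*} [NormedAddCommGroup E] [NormedSpace ℝ E]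
  [FiniteDimensional ℝ E] [MeasurableSpace E] [BorelSpace E] (ν : Measure E)
  [ν.IsAddHaarMeasure]

theorem integrable_one_add_norm_rpow_neg_half {m : ℝ} (hm : 2 * (Module.finrank ℝ E : ℝ) < m) :
    Integrable (fun x : E => (1 + ‖x‖) ^ (-m / 2)) ν := by
  rw [neg_div]
  exact integrable_one_add_norm ((lt_div_iff₀' two_pos).2 hm)

theorem lintegral_comp_inv_smul {h : ℝ} (hh : 0 < h) (f : E → ℝ≥0∞) :
    ∫⁻ x, f (h⁻¹ • x) ∂ν = ENNReal.ofReal (h ^ Module.finrank ℝ E) * ∫⁻ u, f u ∂ν := by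
  have hne : h⁻¹ ≠ 0 := inv_ne_zero hh.ne'
  have hmap : ν.map (MeasurableEquiv.smul₀ h⁻¹ hne)
      = ENNReal.ofReal (h ^ Module.finrank ℝ E) • ν := by
    have := Measure.map_addHaar_smul ν hne
    rwa [inv_pow, inv_inv, abs_of_pos (by positivity)] at this
  rw [← smul_eq_mul, ← lintegral_smul_measure, ← hmap, lintegral_map_equiv]
  rfl

end HaarMeasure

variable {d : ℕ} {K : EuclideanSpace ℝ (Fin d) → ℝ} {h : ℝ}
  {P : Measure (EuclideanSpace ℝ (Fin d))}

theorem aestronglyMeasurable_scaledKernel_prod [SFinite P] (hK : AEStronglyMeasurable K volume)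
    (hh : h ≠ 0) :
    AEStronglyMeasurable (fun q : EuclideanSpace ℝ (Fin d) × EuclideanSpace ℝ (Fin d) =>
      scaledKernel K h q.1 q.2) (volume.prod P) :=
  (hK.comp_quasiMeasurePreserving
    ((Measure.quasiMeasurePreserving_smul volume (inv_ne_zero hh)).comp
      (quasiMeasurePreserving_sub_of_right_invariant volume P))).const_mul _

theorem ofReal_scaledKernel_sq (x z : EuclideanSpace ℝ (Fin d)) :
    ENNReal.ofReal (scaledKernel K h x z ^ 2)
      = ENNReal.ofReal ((1 / h ^ d) ^ 2) * ENNReal.ofReal (K (h⁻¹ • (x - z)) ^ 2) := by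
  rw [← ENNReal.ofReal_mul (by positivity), scaledKernel, mul_pow]

theorem lintegral_scaledKernel_sq (hh : 0 < h) (z : EuclideanSpace ℝ (Fin d)) :
    ∫⁻ x, ENNReal.ofReal (scaledKernel K h x z ^ 2)
      = ENNReal.ofReal (1 / h ^ d) * ∫⁻ u, ENNReal.ofReal (K u ^ 2) := by
  simp only [ofReal_scaledKernel_sq]
  rw [lintegral_const_mul' _ _ ENNReal.ofReal_ne_top,
    lintegral_sub_right_eq_self (fun x => ENNReal.ofReal (K (h⁻¹ • x) ^ 2)) z,
    lintegral_comp_inv_smul volume hh fun u => ENNReal.ofReal (K u ^ 2),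
    finrank_euclideanSpace_fin, ← mul_assoc, ← ENNReal.ofReal_mul (by positivity)]
  congr 2
  field_simp

theorem lintegral_lintegral_scaledKernel_sq [IsProbabilityMeasure P]
    (hK : AEStronglyMeasurable K volume) (hh : 0 < h) :
    ∫⁻ x, ∫⁻ z, ENNReal.ofReal (scaledKernel K h x z ^ 2) ∂P
      = ENNReal.ofReal (1 / h ^ d) * ∫⁻ u, ENNReal.ofReal (K u ^ 2) := by
  rw [lintegral_lintegral_swap
    ((aestronglyMeasurable_scaledKernel_prod hK hh.ne').aemeasurable.pow_const 2).ennreal_ofReal]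
  simp only [lintegral_scaledKernel_sq hh, lintegral_const, measure_univ, mul_one]

theorem lintegral_scaledKernel_sq_le_of_decay {m Cp : ℝ} (hm : 0 ≤ m) (hCp : 0 ≤ Cp)
    (hP : P ≤ volume.withDensity fun z => ENNReal.ofReal (Cp * (1 + ‖z‖) ^ (-m)))
    (hh : 0 < h) (hh1 : h ≤ 1)
    (hK : Integrable (fun u : EuclideanSpace ℝ (Fin d) => (1 + ‖u‖) ^ m * K u ^ 2))
    (x : EuclideanSpace ℝ (Fin d)) :
    ∫⁻ z, ENNReal.ofReal (scaledKernel K h x z ^ 2) ∂P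
      ≤ ENNReal.ofReal (Cp * (∫ u : EuclideanSpace ℝ (Fin d), (1 + ‖u‖) ^ m * K u ^ 2) / h ^ d
          * (1 + ‖x‖) ^ (-m)) := by
  have hweight : ∀ z, ENNReal.ofReal (Cp * (1 + ‖z‖) ^ (-m))
      * ENNReal.ofReal (scaledKernel K h x z ^ 2)
        ≤ ENNReal.ofReal (Cp * (1 + ‖x‖) ^ (-m) * (1 / h ^ d) ^ 2)
          * ENNReal.ofReal ((1 + ‖h⁻¹ • (x - z)‖) ^ m * K (h⁻¹ • (x - z)) ^ 2) := fun z => by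
    rw [← ENNReal.ofReal_mul (by positivity), ← ENNReal.ofReal_mul (by positivity)]
    refine ENNReal.ofReal_le_ofReal ?_
    calc _ ≤ Cp * ((1 + ‖x‖) ^ (-m) * (1 + ‖h⁻¹ • (x - z)‖) ^ m) * scaledKernel K h x z ^ 2 := by
          gcongr
          exact rpow_neg_one_add_norm_le_mul hm hh hh1 x z
      _ = _ := by rw [scaledKernel]; ring
  refine (lintegral_mono' hP le_rfl).trans
    ((lintegral_withDensity_le_lintegral_mul _ (by fun_prop) _).trans
      ((lintegral_mono hweight).trans_eq ?_))
  rw [lintegral_const_mul' _ _ ENNReal.ofReal_ne_top,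
    lintegral_sub_left_eq_self (fun w : EuclideanSpace ℝ (Fin d) =>
      ENNReal.ofReal ((1 + ‖h⁻¹ • w‖) ^ m * K (h⁻¹ • w) ^ 2)) x,
    lintegral_comp_inv_smul volume hh fun u => ENNReal.ofReal ((1 + ‖u‖) ^ m * K u ^ 2),
    ← ofReal_integral_eq_lintegral_ofReal hK (ae_of_all _ fun u => by positivity),
    finrank_euclideanSpace_fin, ← ENNReal.ofReal_mul (by positivity),
    ← ENNReal.ofReal_mul (by positivity)]
  congr 1
  field_simp

end ScaledKernel

/-! ### The kernel density estimator -/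

section Estimator

theorem eLpNorm_two_sq_eq_lintegral_ofReal {α : Type*} [MeasurableSpace α] (ν : Measure α)
    (f : α → ℝ) : eLpNorm f 2 ν ^ 2 = ∫⁻ x, ENNReal.ofReal (f x ^ 2) ∂ν := by
  have hpow := eLpNorm_nnreal_pow_eq_lintegral (f := f) (μ := ν) (p := 2) two_ne_zero
  simpa [Real.enorm_eq_ofReal_abs, ← ENNReal.ofReal_pow] using hpow

theorem lintegral_ofReal_abs_le_ofReal_sqrt {α : Type*} [MeasurableSpace α] {ν : Measure α}
    [IsProbabilityMeasure ν] {f : α → ℝ} (hf : AEStronglyMeasurable f ν) {s : ℝ}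
    (hs : ∫⁻ x, ENNReal.ofReal (f x ^ 2) ∂ν ≤ ENNReal.ofReal s) :
    ∫⁻ x, ENNReal.ofReal |f x| ∂ν ≤ ENNReal.ofReal √s := by
  have hL1 : ∫⁻ x, ENNReal.ofReal |f x| ∂ν = eLpNorm f 1 ν := by
    simp only [eLpNorm_one_eq_lintegral_enorm, Real.enorm_eq_ofReal_abs]
  rw [hL1, ← ENNReal.pow_le_pow_left_iff two_ne_zero, ← ENNReal.ofReal_pow (Real.sqrt_nonneg s)]
  calc eLpNorm f 1 ν ^ 2 ≤ eLpNorm f 2 ν ^ 2 := by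
        gcongr
        exact eLpNorm_le_eLpNorm_of_exponent_le one_le_two hf
    _ = ∫⁻ x, ENNReal.ofReal (f x ^ 2) ∂ν := eLpNorm_two_sq_eq_lintegral_ofReal ν f
    _ ≤ ENNReal.ofReal (√s ^ 2) := hs.trans (ENNReal.ofReal_le_ofReal (by simp [Real.sq_sqrt']))

theorem sqrt_div_mul_rpow_neg {C D n h t m : ℝ} (hCD : 0 ≤ C * D) (hn : 0 ≤ n) (hh : 0 ≤ h)
    (ht : 0 ≤ t) (k : ℕ) :
    √(C / n * (D / h ^ k * t ^ (-m))) = √(C * D) / (√n * h ^ ((k : ℝ) / 2)) * t ^ (-m / 2) := by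
  have hsqrt_t : √(t ^ (-m)) = t ^ (-m / 2) := by
    rw [Real.sqrt_eq_rpow, ← Real.rpow_mul ht, mul_one_div]
  have hsqrt_h : √(h ^ k) = h ^ ((k : ℝ) / 2) := by
    rw [Real.sqrt_eq_rpow, ← Real.rpow_natCast, ← Real.rpow_mul hh, mul_one_div]
  rw [← mul_assoc, div_mul_div_comm, Real.sqrt_mul (by positivity), Real.sqrt_div hCD,
    Real.sqrt_mul hn, hsqrt_t, hsqrt_h]

theorem isBigO_toReal_of_eventually_le {ι : Type*} {l : Filter ι} {F : ι → ℝ≥0∞} {g : ι → ℝ}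
    {c : ℝ} (h : ∀ᶠ i in l, F i ≤ ENNReal.ofReal (c * g i)) :
    (fun i => (F i).toReal) =O[l] g := by
  refine IsBigO.of_bound |c| ?_
  filter_upwards [h] with i hi
  rw [Real.norm_of_nonneg ENNReal.toReal_nonneg, Real.norm_eq_abs, ← abs_mul]
  exact ENNReal.toReal_le_of_le_ofReal (abs_nonneg _)
    (hi.trans (ENNReal.ofReal_le_ofReal (le_abs_self _)))

variable {d : ℕ} {Ω : Type*} [MeasurableSpace Ω] {μ : Measure Ω} [IsProbabilityMeasure μ]
  {P : Measure (EuclideanSpace ℝ (Fin d))} [IsProbabilityMeasure P]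
  {Z : ℕ → Ω → EuclideanSpace ℝ (Fin d)} {K : EuclideanSpace ℝ (Fin d) → ℝ} {C h : ℝ} {N : ℕ}

theorem integratedVariance_le (hC : 0 < C) (hZ : HasLinearVarianceGrowth C Z P μ)
    (hP : ∀ n, MeasurePreserving (Z n) μ P) (hK : MemLp K 2 volume) (hh : 0 < h) (hN : N ≠ 0) :
    integratedVariance μ P K h Z N
      ≤ ENNReal.ofReal (C / ((N : ℝ) * h ^ d) * (eLpNorm K 2 volume).toReal ^ 2) := by
  calc integratedVariance μ P K h Z N
      ≤ ∫⁻ x, ENNReal.ofReal (C / N) * ∫⁻ z, ENNReal.ofReal (scaledKernel K h x z ^ 2) ∂P := by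
        refine lintegral_mono_ae ?_
        filter_upwards [(aestronglyMeasurable_scaledKernel_prod (P := P) hK.1 hh.ne').prodMk_left]
          with x hx
        exact hZ.lintegral_sq_average_sub_le hC hP hx hN
    _ = ENNReal.ofReal (C / N) * (ENNReal.ofReal (1 / h ^ d) * eLpNorm K 2 volume ^ 2) := by
      rw [lintegral_const_mul' _ _ ENNReal.ofReal_ne_top,
        lintegral_lintegral_scaledKernel_sq hK.1 hh, eLpNorm_two_sq_eq_lintegral_ofReal]
    _ = _ := by
      rw [← ENNReal.ofReal_toReal hK.2.ne, ← ENNReal.ofReal_pow ENNReal.toReal_nonneg,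
        ← ENNReal.ofReal_mul (by positivity), ← ENNReal.ofReal_mul (by positivity), ← mul_assoc,
        div_mul_div_comm, mul_one, ENNReal.ofReal_toReal hK.2.ne]

theorem lintegral_abs_kdeDeviation_le (hC : 0 < C) (hZ : HasLinearVarianceGrowth C Z P μ)
    (hP : ∀ n, MeasurePreserving (Z n) μ P) {x : EuclideanSpace ℝ (Fin d)}
    (hx : AEStronglyMeasurable (scaledKernel K h x) P) {s : ℝ}
    (hs : ∫⁻ z, ENNReal.ofReal (scaledKernel K h x z ^ 2) ∂P ≤ ENNReal.ofReal s) (hN : N ≠ 0) :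
    ∫⁻ ω, ENNReal.ofReal |kdeDeviation P K h Z N ω x| ∂μ ≤ ENNReal.ofReal √(C / N * s) := by
  have hdev : AEStronglyMeasurable (fun ω => kdeDeviation P K h Z N ω x) μ :=
    ((Finset.aestronglyMeasurable_fun_sum _ fun k _ =>
      hx.comp_measurePreserving (hP k)).const_mul _).sub aestronglyMeasurable_const
  refine lintegral_ofReal_abs_le_ofReal_sqrt hdev ?_
  rw [ENNReal.ofReal_mul (by positivity)]
  exact (hZ.lintegral_sq_average_sub_le hC hP hx hN).trans (by gcongr)

theorem integratedMAD_le (hC : 0 < C) (hZ : HasLinearVarianceGrowth C Z P μ)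
    (hP : ∀ n, MeasurePreserving (Z n) μ P) (hK : AEStronglyMeasurable K volume) (hh : 0 < h)
    (hh1 : h ≤ 1) {m Cp : ℝ} (hm : 2 * (d : ℝ) < m) (hCp : 0 ≤ Cp)
    (hKm : Integrable (fun u : EuclideanSpace ℝ (Fin d) => (1 + ‖u‖) ^ m * K u ^ 2))
    (hdecay : P ≤ volume.withDensity fun z => ENNReal.ofReal (Cp * (1 + ‖z‖) ^ (-m)))
    (hN : N ≠ 0) :
    integratedMAD μ P K h Z N
      ≤ ENNReal.ofReal
          (√(C * Cp * ∫ u : EuclideanSpace ℝ (Fin d), (1 + ‖u‖) ^ m * K u ^ 2)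
              * (∫ x : EuclideanSpace ℝ (Fin d), (1 + ‖x‖) ^ (-m / 2))
            / (√(N : ℝ) * h ^ ((d : ℝ) / 2))) := by
  have hm0 : 0 ≤ m := le_trans (by positivity) hm.le
  refine (lintegral_mono_ae ?_).trans_eq
    (b := ∫⁻ x : EuclideanSpace ℝ (Fin d), ENNReal.ofReal
      (√(C * Cp * ∫ u : EuclideanSpace ℝ (Fin d), (1 + ‖u‖) ^ m * K u ^ 2)
        / (√(N : ℝ) * h ^ ((d : ℝ) / 2)) * (1 + ‖x‖) ^ (-m / 2))) ?_
  · filter_upwards [(aestronglyMeasurable_scaledKernel_prod (P := P) hK hh.ne').prodMk_left]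
      with x hx
    rw [mul_assoc C, ← sqrt_div_mul_rpow_neg (by positivity) N.cast_nonneg hh.le (by positivity)]
    exact lintegral_abs_kdeDeviation_le hC hZ hP hx
      (lintegral_scaledKernel_sq_le_of_decay hm0 hCp hdecay hh hh1 hKm x) hN
  · rw [← ofReal_integral_eq_lintegral_ofReal
        ((integrable_one_add_norm_rpow_neg_half volume (by simpa using hm)).const_mul _)
        (ae_of_all _ fun x => by positivity),
      integral_const_mul, div_mul_eq_mul_div]

end Estimator

theorem mainTheorem8_general {d : ℕ} {Ω : Type*} [MeasurableSpace Ω] (μ : Measure Ω)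
    [IsProbabilityMeasure μ]
    (P : Measure (EuclideanSpace ℝ (Fin d))) [IsProbabilityMeasure P]
    (Z : ℕ → Ω → EuclideanSpace ℝ (Fin d))
    (hZ : IsIIDSample Z P μ ∨ IsStationaryChainWithGap Z P μ) :
    ∃ Cmc : ℝ, 0 < Cmc ∧
      ∀ (K : EuclideanSpace ℝ (Fin d) → ℝ) (h : ℕ → ℝ),
        MemLp K 2 volume → (∀ N, 0 < h N) → Tendsto h atTop (𝓝 0) →
        ((∀ N : ℕ, 1 ≤ N →
            integratedVariance μ P K (h N) Z N
              ≤ ENNReal.ofReal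
                  (Cmc / ((N : ℝ) * h N ^ d) * (eLpNorm K 2 volume).toReal ^ 2)) ∧
          (fun N : ℕ => (integratedVariance μ P K (h N) Z N).toReal)
            =O[atTop] fun N : ℕ => 1 / ((N : ℝ) * h N ^ d)) ∧
        ∀ (m Cp : ℝ), 2 * (d : ℝ) < m → 0 < Cp →
          Integrable (fun u : EuclideanSpace ℝ (Fin d) => (1 + ‖u‖) ^ m * K u ^ 2) volume →
          P ≤ volume.withDensity (fun x => ENNReal.ofReal (Cp * (1 + ‖x‖) ^ (-m))) →
          Integrable (fun x : EuclideanSpace ℝ (Fin d) => (1 + ‖x‖) ^ (-m / 2)) volume ∧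
          (∀ N : ℕ, 1 ≤ N → h N < 1 →
            integratedMAD μ P K (h N) Z N
              ≤ ENNReal.ofReal
                  (√(Cmc * Cp * ∫ u : EuclideanSpace ℝ (Fin d), (1 + ‖u‖) ^ m * K u ^ 2)
                      * (∫ x : EuclideanSpace ℝ (Fin d), (1 + ‖x‖) ^ (-m / 2))
                    / (√(N : ℝ) * h N ^ ((d : ℝ) / 2)))) ∧
          (fun N : ℕ => (integratedMAD μ P K (h N) Z N).toReal)
            =O[atTop] fun N : ℕ => 1 / (√(N : ℝ) * h N ^ ((d : ℝ) / 2)) := by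
  obtain ⟨hP, C, hC, hvar⟩ := measurePreserving_and_exists_hasLinearVarianceGrowth hZ
  refine ⟨C, hC, fun K h hK hh h0 => ⟨?_, fun m Cp hm hCp hKm hdecay => ?_⟩⟩
  · have hle := fun N (hN : 1 ≤ N) =>
      integratedVariance_le hC hvar hP hK (hh N) (Nat.one_le_iff_ne_zero.1 hN)
    refine ⟨hle, isBigO_toReal_of_eventually_le (c := C * (eLpNorm K 2 volume).toReal ^ 2) ?_⟩
    filter_upwards [eventually_ge_atTop 1] with N hN
    rw [mul_one_div, mul_div_right_comm]
    exact hle N hN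
  · have hle := fun N (hN : 1 ≤ N) (hN1 : h N < 1) =>
      integratedMAD_le hC hvar hP hK.1 (hh N) hN1.le hm hCp.le hKm hdecay
        (Nat.one_le_iff_ne_zero.1 hN)
    refine ⟨integrable_one_add_norm_rpow_neg_half volume (by simpa using hm), hle,
      isBigO_toReal_of_eventually_le
        (c := √(C * Cp * ∫ u : EuclideanSpace ℝ (Fin d), (1 + ‖u‖) ^ m * K u ^ 2)
          * ∫ x : EuclideanSpace ℝ (Fin d), (1 + ‖x‖) ^ (-m / 2)) ?_⟩
    filter_upwards [eventually_ge_atTop 1, h0.eventually_lt_const one_pos] with N hN hN1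
    rw [mul_one_div]
    exact hle N hN hN1

theorem mainTheorem8 {d : ℕ} {Ω : Type*} [MeasurableSpace Ω] (μ : Measure Ω)
    [IsProbabilityMeasure μ]
    (P : Measure (EuclideanSpace ℝ (Fin d))) [IsProbabilityMeasure P]
    (p : EuclideanSpace ℝ (Fin d) → ℝ) (hp : IsSobolevDensity P p)
    (Z : ℕ → Ω → EuclideanSpace ℝ (Fin d))
    (hZ : IsIIDSample Z P μ ∨ IsStationaryChainWithGap Z P μ) :
    ∃ Cmc : ℝ, 0 < Cmc ∧
      ∀ (K : EuclideanSpace ℝ (Fin d) → ℝ) (h : ℕ → ℝ),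
        IsSmoothingKernel K → IsBandwidth d h →
        ((∀ N : ℕ, 1 ≤ N →
            integratedVariance μ P K (h N) Z N
              ≤ ENNReal.ofReal
                  (Cmc / ((N : ℝ) * h N ^ d) * (eLpNorm K 2 volume).toReal ^ 2)) ∧
          (fun N : ℕ => (integratedVariance μ P K (h N) Z N).toReal)
            =O[atTop] fun N : ℕ => 1 / ((N : ℝ) * h N ^ d)) ∧
        ∀ (m Cp : ℝ), 2 * (d : ℝ) < m → 0 < Cp →
          Integrable (fun u : EuclideanSpace ℝ (Fin d) => (1 + ‖u‖) ^ m * K u ^ 2) volume →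
          (∀ᵐ x : EuclideanSpace ℝ (Fin d), p x ≤ Cp * (1 + ‖x‖) ^ (-m)) →
          Integrable (fun x : EuclideanSpace ℝ (Fin d) => (1 + ‖x‖) ^ (-m / 2)) volume ∧
          (∀ N : ℕ, 1 ≤ N → h N < 1 →
            integratedMAD μ P K (h N) Z N
              ≤ ENNReal.ofReal
                  (√(Cmc * Cp * ∫ u : EuclideanSpace ℝ (Fin d), (1 + ‖u‖) ^ m * K u ^ 2)
                      * (∫ x : EuclideanSpace ℝ (Fin d), (1 + ‖x‖) ^ (-m / 2))
                    / (√(N : ℝ) * h N ^ ((d : ℝ) / 2)))) ∧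
          (fun N : ℕ => (integratedMAD μ P K (h N) Z N).toReal)
            =O[atTop] fun N : ℕ => 1 / (√(N : ℝ) * h N ^ ((d : ℝ) / 2)) := by
  obtain ⟨C, hC, hle⟩ := mainTheorem8_general μ P Z hZ
  refine ⟨C, hC, fun K h hK hh => (hle K h hK.memLp_two hh.pos hh.tendsto_zero).imp_right
    fun hmad m Cp hm hCp hKm hdecay => hmad m Cp hm hCp hKm (hp.density ▸ withDensity_mono ?_)⟩
  exact hdecay.mono fun x hx => ENNReal.ofReal_le_ofReal hx
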